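/- Let $k$ be a positive integer with $k \equiv 12 \pmod{15}$. Then \[ n = \frac{512k^5+1280k^4+6080k^3+7840k^2+10010k+3741}{3125} \] is a positive integer, and there is an undirected circulant graph of degree $10$, that is, an undirected Cayley graph of the cyclic group $\mathbb{Z}_n$ on five generators, which has order $n$ and diameter exactly $k$. Moreover, a generating set is $\{1,g_2,g_3,g_4,g_5\}$, where \[ g_2=\frac{128k^4+256k^3+1192k^2+1064k+883}{625}, \] \[ g_3=\frac{512k^5+1920k^4+6560k^3+14600k^2+7980k+10431}{9375}, \] \[ g_4=\frac{512k^5+1920k^4+6560k^3+14600k^2+15480k+14181}{9375}, \] \[ g_5=\frac{512k^5+1920k^4+8960k^3+18200k^2+28530k+20106}{9375} \] are positive integers. That is, the five residues $1,g_2,g_3,g_4,g_5$ modulo $n$ are distinct, and the graph with vertex set $\mathbb{Z}_n$ in which $u$ and $v$ are adjacent if and only if $u-v\in\{\pm1,\pm g_2,\pm g_3,\pm g_4,\pm g_5\}$ is connected, regular of degree $10$, and has diameter $k$. -/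

import Mathlib

/-! Words in the generators are vectors of `ℤ^5`, and those representing `0` in `ZMod n` form a
lattice L (`circOrder_dvd_iff`). So the diameter is the `ℓ¹` covering radius of L in `ℤ^5`. For k =
15m + 12, L is `bowtieLattice a` with a = 6m + 5, and k = ⌊5a/2⌋.

Upper bound (`exists_close`): the even lattice vectors (e = 0) are the column combinations of 2aI +
P. Changing parity in a direction s with entries ±1 adds as + Ps/2, since P kills the all-ones
vector. As P is skew, this step has `ℓ¹` length 5a when its coordinates have the signs s. A point in
the box between its two ends is within 5a/2 of one of them. After reduction modulo L, every point
lies in such a box.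

Lower bound (`le_l1_deepHole_sub`): P is so sparse that vectors with entries of size at most (a +
1)/2 are shortest in their classes modulo the columns. For the deep hole this covers both parities.
-/

/-- The `ℓ¹` norm of an integer vector. -/
def l1 {ι : Type*} [Fintype ι] (x : ι → ℤ) : ℕ := ∑ i, (x i).natAbs

/-! ### Distances in circulant graphs and coefficient vectors -/

lemma edist_add_nsmul_le {G : Type*} [AddCommGroup G] (S : Set G) {g : G} (hg : g ∈ S ∨ -g ∈ S)
    (u : G) (j : ℕ) : (SimpleGraph.circulantGraph S).edist u (u + j • g) ≤ (j : ℕ∞) := by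
  induction j with
  | zero => simp
  | succ j ih =>
    refine (SimpleGraph.edist_triangle (v := u + j • g)).trans ?_
    push_cast
    refine add_le_add ih ?_
    rw [SimpleGraph.edist_le_one_iff_adj_or_eq]
    by_cases h : u + j • g = u + (j + 1) • g
    · exact Or.inr h
    · left
      rw [SimpleGraph.circulantGraph, SimpleGraph.fromRel_adj]
      refine ⟨h, ?_⟩
      have e : u + (j + 1) • g - (u + j • g) = g := by rw [succ_nsmul]; abel
      have e' : u + j • g - (u + (j + 1) • g) = -g := by rw [succ_nsmul]; abel
      rw [e, e']
      exact hg.symm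

lemma edist_add_zsmul_le {G : Type*} [AddCommGroup G] {S : Set G} {g : G} (hg : g ∈ S)
    (u : G) (j : ℤ) :
    (SimpleGraph.circulantGraph S).edist u (u + j • g) ≤ (j.natAbs : ℕ∞) := by
  rcases Int.natAbs_eq j with h | h
  · have := edist_add_nsmul_le S (Or.inl hg) u j.natAbs
    rwa [← natCast_zsmul, ← h] at this
  · have := edist_add_nsmul_le S (g := -g) (Or.inr (by simpa using hg)) u j.natAbs
    rwa [← natCast_zsmul, smul_neg, ← neg_smul, ← h] at this

lemma edist_add_sum_zsmul_le {G ι : Type*} [AddCommGroup G] (g : ι → G)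
    (x : ι → ℤ) (s : Finset ι) (u : G) :
    (SimpleGraph.circulantGraph (Set.range g)).edist u (u + ∑ i ∈ s, x i • g i) ≤
      ((∑ i ∈ s, (x i).natAbs : ℕ) : ℕ∞) := by
  classical
  induction s using Finset.induction_on with
  | empty => simp
  | insert i s hi ih =>
    rw [Finset.sum_insert hi, Finset.sum_insert hi, add_comm (x i • g i), ← add_assoc,
      add_comm (x i).natAbs]
    push_cast at ih ⊢
    exact SimpleGraph.edist_triangle.trans
      (add_le_add ih (edist_add_zsmul_le (Set.mem_range_self i) _ _))

lemma exists_coeff_of_walk {G ι : Type*} [AddCommGroup G] [Fintype ι] (g : ι → G) {u v : G}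
    (p : (SimpleGraph.circulantGraph (Set.range g)).Walk u v) :
    ∃ x : ι → ℤ, l1 x ≤ p.length ∧ v - u = ∑ i, x i • g i := by
  classical
  induction p with
  | nil => exact ⟨0, by simp [l1], by simp⟩
  | @cons u w v h p ih =>
    obtain ⟨x, hx, e⟩ := ih
    have key : ∀ (i : ι) (z : ℤ), z.natAbs = 1 → w - u = z • g i →
        ∃ y : ι → ℤ, l1 y ≤ (SimpleGraph.Walk.cons h p).length ∧ v - u = ∑ i, y i • g i := by
      intro i z hz hw
      refine ⟨x + Pi.single i z, ?_, ?_⟩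
      · rw [SimpleGraph.Walk.length_cons]
        have h1 : l1 (x + Pi.single i z) ≤ l1 x + l1 (Pi.single i z : ι → ℤ) := by
          unfold l1
          rw [← Finset.sum_add_distrib]
          exact Finset.sum_le_sum fun j _ => Int.natAbs_add_le _ _
        have h2 : l1 (Pi.single i z : ι → ℤ) = 1 := by
          unfold l1
          rw [Finset.sum_eq_single i] <;> simp_all
        omega
      · have h3 : ∑ j, (Pi.single i z : ι → ℤ) j • g j = z • g i := by
          rw [Finset.sum_eq_single i] <;> simp_all
        simp only [Pi.add_apply, add_smul, Finset.sum_add_distrib]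
        rw [h3, ← e, ← hw]
        abel
    rw [SimpleGraph.circulantGraph, SimpleGraph.fromRel_adj] at h
    rcases h.2 with ⟨i, hi⟩ | ⟨i, hi⟩
    · exact key i (-1) rfl (by rw [neg_smul, one_smul, hi]; abel)
    · exact key i 1 rfl (by rw [one_smul, hi])

lemma coe_l1 (x : Fin 5 → ℤ) :
    (l1 x : ℤ) = |x 0| + |x 1| + |x 2| + |x 3| + |x 4| := by
  simp [l1, Fin.sum_univ_five]

/-! ### The bow-tie lattice -/

/-- The lattice spanned by the columns of `2 a I + P`, where `P` is the skew-symmetric incidence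
matrix of two directed triangles sharing a vertex, and by half the sum of these columns. -/
def bowtieLattice (a : ℤ) : AddSubgroup (Fin 5 → ℤ) where
  carrier := {x | ∃ c₀ c₁ c₂ c₃ c₄ e : ℤ,
    x 0 = 2 * a * c₀ - c₂ + c₃ + a * e ∧ x 1 = 2 * a * c₁ + c₃ - c₄ + a * e ∧
    x 2 = 2 * a * c₂ + c₀ - c₃ + a * e ∧ x 3 = 2 * a * c₃ - c₀ - c₁ + c₂ + c₄ + a * e ∧
    x 4 = 2 * a * c₄ + c₁ - c₃ + a * e}
  zero_mem' := ⟨0, 0, 0, 0, 0, 0, by simp⟩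
  add_mem' := by
    rintro x y ⟨c₀, c₁, c₂, c₃, c₄, e, h0, h1, h2, h3, h4⟩ ⟨d₀, d₁, d₂, d₃, d₄, f, k0, k1, k2, k3, k4⟩
    refine ⟨c₀ + d₀, c₁ + d₁, c₂ + d₂, c₃ + d₃, c₄ + d₄, e + f, ?_, ?_, ?_, ?_, ?_⟩ <;>
      simp only [Pi.add_apply, *] <;> ring
  neg_mem' := by
    rintro x ⟨c₀, c₁, c₂, c₃, c₄, e, h0, h1, h2, h3, h4⟩
    refine ⟨-c₀, -c₁, -c₂, -c₃, -c₄, -e, ?_, ?_, ?_, ?_, ?_⟩ <;>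
      simp only [Pi.neg_apply, *] <;> ring

lemma mem_bowtieLattice_iff {a : ℤ} {x : Fin 5 → ℤ} : x ∈ bowtieLattice a ↔
    ∃ c₀ c₁ c₂ c₃ c₄ e : ℤ,
    x 0 = 2 * a * c₀ - c₂ + c₃ + a * e ∧ x 1 = 2 * a * c₁ + c₃ - c₄ + a * e ∧
    x 2 = 2 * a * c₂ + c₀ - c₃ + a * e ∧ x 3 = 2 * a * c₃ - c₀ - c₁ + c₂ + c₄ + a * e ∧
    x 4 = 2 * a * c₄ + c₁ - c₃ + a * e := Iff.rfl

/-- The lattice vector with given coefficients. -/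
def bowtieVec (a c₀ c₁ c₂ c₃ c₄ e : ℤ) : Fin 5 → ℤ :=
  ![2 * a * c₀ - c₂ + c₃ + a * e, 2 * a * c₁ + c₃ - c₄ + a * e,
    2 * a * c₂ + c₀ - c₃ + a * e, 2 * a * c₃ - c₀ - c₁ + c₂ + c₄ + a * e,
    2 * a * c₄ + c₁ - c₃ + a * e]

lemma bowtieVec_mem (a c₀ c₁ c₂ c₃ c₄ e : ℤ) :
    bowtieVec a c₀ c₁ c₂ c₃ c₄ e ∈ bowtieLattice a :=
  ⟨c₀, c₁, c₂, c₃, c₄, e, rfl, rfl, rfl, rfl, rfl⟩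

lemma l1_sub_bowtieVec (x : Fin 5 → ℤ) (a c₀ c₁ c₂ c₃ c₄ e : ℤ) :
    (l1 (x - bowtieVec a c₀ c₁ c₂ c₃ c₄ e) : ℤ) =
      |x 0 - (2 * a * c₀ - c₂ + c₃ + a * e)| + |x 1 - (2 * a * c₁ + c₃ - c₄ + a * e)| +
      |x 2 - (2 * a * c₂ + c₀ - c₃ + a * e)| +
      |x 3 - (2 * a * c₃ - c₀ - c₁ + c₂ + c₄ + a * e)| +
      |x 4 - (2 * a * c₄ + c₁ - c₃ + a * e)| := by
  rw [coe_l1]; rfl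

lemma exists_minimal_l1 (L : AddSubgroup (Fin 5 → ℤ)) (x : Fin 5 → ℤ) :
    ∃ l ∈ L, ∀ l' ∈ L, l1 (x - l) ≤ l1 (x - l - l') := by
  classical
  have hne : ∃ j, ∃ l ∈ L, l1 (x - l) = j := ⟨_, 0, L.zero_mem, rfl⟩
  obtain ⟨l, hl, e⟩ := Nat.find_spec hne
  refine ⟨l, hl, fun l' hl' => ?_⟩
  rw [e]
  exact Nat.find_min' hne ⟨l + l', L.add_mem hl hl', by rw [sub_sub]⟩

/-! ### Lower bound for the covering radius -/

lemma le_abs_sub_mul {a t c : ℤ} (ha : 5 ≤ a) (ht : 2 * |t| ≤ a + 1) :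
    |t| + 4 * |c| ≤ |t - 2 * a * c| := by
  have h1 : |2 * a * c| = 2 * a * |c| := by
    rw [abs_mul, abs_of_nonneg (by linarith : (0 : ℤ) ≤ 2 * a)]
  rcases eq_or_ne c 0 with rfl | hc
  · simp
  · have h2 : 1 ≤ |c| := Int.one_le_abs hc
    have h3 : |2 * a * c| - |t| ≤ |t - 2 * a * c| := by
      rw [abs_sub_comm]; exact abs_sub_abs_le_abs_sub _ _
    nlinarith

/-- Subtracting 2ac costs at least 4|cᵢ| in coordinate i, while the off-diagonal entries recover at
most 4|c₃| and 2|cᵢ| for the other i, the `ℓ¹` norms of the columns of P. -/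
lemma sum_abs_le_of_residual {a c₀ c₁ c₂ c₃ c₄ t₀ t₁ t₂ t₃ t₄ : ℤ} (ha : 5 ≤ a)
    (h0 : 2 * |t₀| ≤ a + 1) (h1 : 2 * |t₁| ≤ a + 1) (h2 : 2 * |t₂| ≤ a + 1)
    (h3 : 2 * |t₃| ≤ a + 1) (h4 : 2 * |t₄| ≤ a + 1) :
    |t₀| + |t₁| + |t₂| + |t₃| + |t₄| ≤
      |t₀ - (2 * a * c₀ - c₂ + c₃)| + |t₁ - (2 * a * c₁ + c₃ - c₄)| +
      |t₂ - (2 * a * c₂ + c₀ - c₃)| + |t₃ - (2 * a * c₃ - c₀ - c₁ + c₂ + c₄)| +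
      |t₄ - (2 * a * c₄ + c₁ - c₃)| := by
  have k0 := le_abs_sub_mul (c := c₀) ha h0
  have k1 := le_abs_sub_mul (c := c₁) ha h1
  have k2 := le_abs_sub_mul (c := c₂) ha h2
  have k3 := le_abs_sub_mul (c := c₃) ha h3
  have k4 := le_abs_sub_mul (c := c₄) ha h4
  have tri : ∀ p q : ℤ, |p| - |q| ≤ |p - q| := fun p q => abs_sub_abs_le_abs_sub p q
  have m0 := tri (t₀ - 2 * a * c₀) (c₃ - c₂)
  have m1 := tri (t₁ - 2 * a * c₁) (c₃ - c₄)
  have m2 := tri (t₂ - 2 * a * c₂) (c₀ - c₃)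
  have m3 := tri (t₃ - 2 * a * c₃) ((c₂ - c₀) + (c₄ - c₁))
  have m4 := tri (t₄ - 2 * a * c₄) (c₁ - c₃)
  have b0 := abs_sub c₃ c₂
  have b1 := abs_sub c₃ c₄
  have b2 := abs_sub c₀ c₃
  have b3 := (abs_add_le (c₂ - c₀) (c₄ - c₁)).trans (add_le_add (abs_sub _ _) (abs_sub _ _))
  have b4 := abs_sub c₁ c₃
  have e0 : t₀ - (2 * a * c₀ - c₂ + c₃) = t₀ - 2 * a * c₀ - (c₃ - c₂) := by ring
  have e1 : t₁ - (2 * a * c₁ + c₃ - c₄) = t₁ - 2 * a * c₁ - (c₃ - c₄) := by ring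
  have e2 : t₂ - (2 * a * c₂ + c₀ - c₃) = t₂ - 2 * a * c₂ - (c₀ - c₃) := by ring
  have e3 : t₃ - (2 * a * c₃ - c₀ - c₁ + c₂ + c₄) =
    t₃ - 2 * a * c₃ - ((c₂ - c₀) + (c₄ - c₁)) := by ring
  have e4 : t₄ - (2 * a * c₄ + c₁ - c₃) = t₄ - 2 * a * c₄ - (c₁ - c₃) := by ring
  rw [e0, e1, e2, e3, e4]
  linarith [abs_nonneg c₀, abs_nonneg c₁, abs_nonneg c₂, abs_nonneg c₄]

/-- A deep hole of the lattice. -/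
lemma le_l1_deepHole_sub {h : ℤ} (hh : 2 ≤ h) {l : Fin 5 → ℤ}
    (hl : l ∈ bowtieLattice (2 * h + 1)) :
    5 * h + 2 ≤ l1 (![h, h, h, h + 1, h + 1] - l) := by
  obtain ⟨c₀, c₁, c₂, c₃, c₄, e, h0, h1, h2, h3, h4⟩ := hl
  rw [coe_l1]
  have aux : ∀ t : ℤ, 0 ≤ t → t ≤ h + 1 → 2 * |t| ≤ (2 * h + 1) + 1 := by
    intro t ht ht'
    rw [abs_of_nonneg ht]
    linarith
  have p0 : 0 ≤ h := by linarith
  -- An even e is absorbed into the cᵢ, because P kills the all-ones vector. An odd e also shifts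
  -- the hole by -a in each coordinate, giving entries -(h + 1) and -h.
  rcases Int.even_or_odd' e with ⟨f, hf | hf⟩
  · have := sum_abs_le_of_residual (a := 2 * h + 1) (c₀ := c₀ + f) (c₁ := c₁ + f) (c₂ := c₂ + f)
      (c₃ := c₃ + f) (c₄ := c₄ + f) (by linarith) (aux h p0 (by linarith)) (aux h p0 (by linarith))
      (aux h p0 (by linarith)) (aux (h + 1) (by linarith) le_rfl)
      (aux (h + 1) (by linarith) le_rfl)
    rw [abs_of_nonneg p0, abs_of_nonneg (by linarith : 0 ≤ h + 1)] at this
    refine le_trans (by linarith) (this.trans (le_of_eq ?_))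
    simp only [Pi.sub_apply, h0, h1, h2, h3, h4, hf]
    simp only [Matrix.cons_val]
    ring_nf
  · have aux' : ∀ t : ℤ, 0 ≤ t → t ≤ h + 1 → 2 * |-t| ≤ (2 * h + 1) + 1 := by
      intro t ht ht'
      rw [abs_neg]
      exact aux t ht ht'
    have := sum_abs_le_of_residual (a := 2 * h + 1) (c₀ := c₀ + f) (c₁ := c₁ + f) (c₂ := c₂ + f)
      (c₃ := c₃ + f) (c₄ := c₄ + f) (by linarith) (aux' (h + 1) (by linarith) le_rfl)
      (aux' (h + 1) (by linarith) le_rfl) (aux' (h + 1) (by linarith) le_rfl)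
      (aux' h p0 (by linarith)) (aux' h p0 (by linarith))
    rw [abs_neg, abs_neg, abs_of_nonneg p0, abs_of_nonneg (by linarith : 0 ≤ h + 1)] at this
    refine le_trans (by linarith) (this.trans (le_of_eq ?_))
    simp only [Pi.sub_apply, h0, h1, h2, h3, h4, hf]
    simp only [Matrix.cons_val]
    ring_nf

/-! ### Upper bound for the covering radius -/

/-- The coordinates `x`, `z` lie between the `2 a c - d`, `2 a d + c` of an even lattice vector and
those of the odd one reached from it in the directions `2 p - 1`, `2 q - 1`, `2 t - 1`. -/
def PairCell (a t x z c p d q : ℤ) : Prop :=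
  (p = 0 ∨ p = 1) ∧ (q = 0 ∨ q = 1) ∧ (c + p = 0 ∨ c + p = 1) ∧ (d + q = 0 ∨ d + q = 1) ∧
  0 ≤ (2 * p - 1) * (x - (2 * a * c - d)) ∧
  0 ≤ (2 * p - 1) * (2 * a * c - d + a * (2 * p - 1) + t - q - x) ∧
  0 ≤ (2 * q - 1) * (z - (2 * a * d + c)) ∧
  0 ≤ (2 * q - 1) * (2 * a * d + c + a * (2 * q - 1) + p - t - z)

/-- The same cell serves both values of t, so the two triangles are treated independently before the
direction at their shared vertex is chosen. -/
lemma exists_pairCell {a x z : ℤ} (ha : 5 ≤ a) (hx : |x| ≤ a + 1) (hz : |z| ≤ a + 1) :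
    ∃ c p d q : ℤ, PairCell a 1 x z c p d q ∧ PairCell a 0 x z c p d q := by
  rw [abs_le] at hx hz
  unfold PairCell
  rcases le_or_gt 0 x with hx0 | hx0 <;> rcases le_or_gt 0 z with hz0 | hz0
  · by_cases r : x ≤ a - 1 ∧ z ≤ a
    · exact ⟨0, 1, 0, 1, by omega, by omega⟩
    by_cases r : x ≤ a - 1
    · exact ⟨0, 1, 1, 0, by omega, by omega⟩
    by_cases r : z = 0 ∧ x = a
    · exact ⟨0, 1, 0, 0, by omega, by omega⟩
    by_cases r : z = 0
    · exact ⟨1, 0, 0, 0, by omega, by omega⟩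
    by_cases r : z ≤ a
    · exact ⟨1, 0, 0, 1, by omega, by omega⟩
    exact ⟨1, 0, 1, 0, by omega, by omega⟩
  · by_cases r : x ≤ a ∧ -a + 1 ≤ z
    · exact ⟨0, 1, 0, 0, by omega, by omega⟩
    by_cases r : -a + 1 ≤ z
    · exact ⟨1, 0, 0, 0, by omega, by omega⟩
    by_cases r : x = 0 ∧ z = -a
    · exact ⟨0, 0, 0, 0, by omega, by omega⟩
    by_cases r : x = 0
    · exact ⟨0, 0, -1, 1, by omega, by omega⟩
    by_cases r : x ≤ a
    · exact ⟨0, 1, -1, 1, by omega, by omega⟩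
    exact ⟨1, 0, -1, 1, by omega, by omega⟩
  · by_cases r : -a ≤ x ∧ z ≤ a - 1
    · exact ⟨0, 0, 0, 1, by omega, by omega⟩
    by_cases r : z ≤ a - 1
    · exact ⟨-1, 1, 0, 1, by omega, by omega⟩
    by_cases r : -a ≤ x
    · exact ⟨0, 0, 1, 0, by omega, by omega⟩
    exact ⟨-1, 1, 1, 0, by omega, by omega⟩
  · by_cases r : -(a - 1) ≤ x ∧ -a ≤ z
    · exact ⟨0, 0, 0, 0, by omega, by omega⟩
    by_cases r : -(a - 1) ≤ x
    · exact ⟨0, 0, -1, 1, by omega, by omega⟩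
    by_cases r : -a ≤ z
    · exact ⟨-1, 1, 0, 0, by omega, by omega⟩
    exact ⟨-1, 1, -1, 1, by omega, by omega⟩

lemma abs_add_abs_of_between {p x l l' : ℤ} (hp : p = 0 ∨ p = 1)
    (h : 0 ≤ (2 * p - 1) * (x - l)) (h' : 0 ≤ (2 * p - 1) * (l' - x)) :
    |x - l| + |x - l'| = (2 * p - 1) * (l' - l) := by
  rcases hp with rfl | rfl
  · rw [abs_of_nonpos (by linarith), abs_of_nonneg (by linarith)]; ring
  · rw [abs_of_nonneg (by linarith), abs_of_nonpos (by linarith)]; ring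

/-- Points of a box spanned by an even and an odd lattice vector are close to one of them. -/
lemma exists_close_of_cells {a t c p d q c' p' d' q' : ℤ} {x : Fin 5 → ℤ} (ht : t = 0 ∨ t = 1)
    (h : PairCell a t (x 0) (x 2) c p d q) (h' : PairCell a t (x 1) (x 4) c' p' d' q')
    (h3 : 0 ≤ (2 * t - 1) * (x 3 - (d - c + d' - c')))
    (h3' : 0 ≤ (2 * t - 1) *
      (a * (2 * t - 1) + (d + q - (c + p) + (d' + q') - (c' + p')) - x 3)) :
    ∃ l ∈ bowtieLattice a, 2 * (l1 (x - l) : ℤ) ≤ 5 * a := by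
  obtain ⟨hp, hq, -, -, h0, h0', h2, h2'⟩ := h
  obtain ⟨hp', hq', -, -, h1, h1', h4, h4'⟩ := h'
  have s0 := abs_add_abs_of_between hp h0 h0'
  have s1 := abs_add_abs_of_between hp' h1 h1'
  have s2 := abs_add_abs_of_between hq h2 h2'
  have s3 := abs_add_abs_of_between ht h3 h3'
  have s4 := abs_add_abs_of_between hq' h4 h4'
  have key : (l1 (x - bowtieVec a c c' d 0 d' 0) : ℤ) +
      l1 (x - bowtieVec a (c + p - 1) (c' + p' - 1) (d + q - 1) (t - 1) (d' + q' - 1) 1) =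
      5 * a := by
    rw [l1_sub_bowtieVec, l1_sub_bowtieVec]
    have sq : ∀ {r : ℤ}, r = 0 ∨ r = 1 → r * r = r := by rintro r (rfl | rfl) <;> rfl
    have hsum := congrArg₂ (· + ·) (congrArg₂ (· + ·) (congrArg₂ (· + ·) s0 s1)
      (congrArg₂ (· + ·) s2 s3)) s4
    refine Eq.trans (Eq.trans ?_ hsum) ?_
    · ring_nf
    -- Idempotence of the bits says that the signs square to 1; the terms from P cancel by
    -- skew-symmetry.
    · linear_combination 4 * a * (sq hp + sq hp' + sq hq + sq hq' + sq ht)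
  rcases le_total (l1 (x - bowtieVec a c c' d 0 d' 0) : ℤ)
    (l1 (x - bowtieVec a (c + p - 1) (c' + p' - 1) (d + q - 1) (t - 1) (d' + q' - 1) 1)) with h | h
  · exact ⟨_, bowtieVec_mem a c c' d 0 d' 0, by linarith⟩
  · exact ⟨_, bowtieVec_mem a (c + p - 1) (c' + p' - 1) (d + q - 1) (t - 1) (d' + q' - 1) 1,
      by linarith⟩

lemma exists_close_of_reduced {a : ℤ} (ha : 5 ≤ a) {x : Fin 5 → ℤ} (h0 : |x 0| ≤ a + 1)
    (h1 : |x 1| ≤ a + 1) (h2 : |x 2| ≤ a + 1) (h4 : |x 4| ≤ a + 1) (h3 : |x 3| ≤ a - 2) :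
    ∃ l ∈ bowtieLattice a, 2 * (l1 (x - l) : ℤ) ≤ 5 * a := by
  obtain ⟨c, p, d, q, hp, hm⟩ := exists_pairCell ha h0 h2
  obtain ⟨c', p', d', q', hp', hm'⟩ := exists_pairCell ha h1 h4
  rw [abs_le] at h3
  obtain ⟨-, -, e1, e2, -⟩ := id hp
  obtain ⟨-, -, e1', e2', -⟩ := id hp'
  -- The odd endpoint is offset from ±a by at most 2, which is where the bound a - 2 on the fourth
  -- coordinate is needed.
  rcases le_total (d - c + d' - c') (x 3) with h | h
  · exact exists_close_of_cells (Or.inr rfl) hp hp' (by omega) (by omega)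
  · exact exists_close_of_cells (Or.inl rfl) hm hm' (by omega) (by omega)

lemma abs_le_of_minimal {a t p : ℤ} (ha : 5 ≤ a) (hp : p ≤ 4)
    (h : |t| ≤ |t - 2 * a| + p) (h' : |t| ≤ |t + 2 * a| + p) : 2 * |t| ≤ 2 * a + p := by
  rcases abs_cases t with ⟨e, _⟩ | ⟨e, _⟩ <;> rcases abs_cases (t - 2 * a) with ⟨e', _⟩ | ⟨e', _⟩ <;>
    rcases abs_cases (t + 2 * a) with ⟨e'', _⟩ | ⟨e'', _⟩ <;> omega

/-- Translates a point with large fourth coordinate to one with small fourth coordinate. -/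
lemma exists_reduced_of_large {a : ℤ} (ha : 5 ≤ a) {x : Fin 5 → ℤ} (h0 : |x 0| ≤ a + 1)
    (h1 : |x 1| ≤ a + 1) (h2 : |x 2| ≤ a + 1) (h4 : |x 4| ≤ a + 1) (h3 : x 3 ≤ a + 2)
    (hl : a - 1 ≤ x 3) (hmin : x 3 = a + 2 → x 0 ≤ 0 ∧ x 1 ≤ 0 ∧ 0 ≤ x 2 ∧ 0 ≤ x 4) :
    ∃ l ∈ bowtieLattice a, |(x - l) 0| ≤ a + 1 ∧ |(x - l) 1| ≤ a + 1 ∧ |(x - l) 2| ≤ a + 1 ∧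
      |(x - l) 4| ≤ a + 1 ∧ |(x - l) 3| ≤ a - 2 := by
  have sgn : ∀ P : Prop, ∃ c : ℤ, (c = 0 ∧ P) ∨ (c = -1 ∧ ¬ P) := fun P => by
    by_cases h : P
    · exact ⟨0, Or.inl ⟨rfl, h⟩⟩
    · exact ⟨-1, Or.inr ⟨rfl, h⟩⟩
  -- Ties at 0 are broken so that, when `x 3 = a + 2`, `hmin` makes the fourth coordinate of the
  -- lattice vector exactly a + 2. Otherwise the difference there is at most 3 ≤ a - 2.
  obtain ⟨c₀, k0⟩ := sgn (0 < x 0)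
  obtain ⟨c₁, k1⟩ := sgn (0 < x 1)
  obtain ⟨c₂, k2⟩ := sgn (0 ≤ x 2)
  obtain ⟨c₄, k4⟩ := sgn (0 ≤ x 4)
  refine ⟨_, bowtieVec_mem a c₀ c₁ c₂ 0 c₄ 1, ?_⟩
  rw [abs_le] at *
  simp only [Pi.sub_apply, bowtieVec, Matrix.cons_val, abs_le]
  rcases k0 with ⟨rfl, k0⟩ | ⟨rfl, k0⟩ <;> rcases k1 with ⟨rfl, k1⟩ | ⟨rfl, k1⟩ <;>
    rcases k2 with ⟨rfl, k2⟩ | ⟨rfl, k2⟩ <;> rcases k4 with ⟨rfl, k4⟩ | ⟨rfl, k4⟩ <;>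
    omega

theorem exists_close {a : ℤ} (ha : 5 ≤ a) (x : Fin 5 → ℤ) :
    ∃ l ∈ bowtieLattice a, 2 * (l1 (x - l) : ℤ) ≤ 5 * a := by
  obtain ⟨l, hl, hmin⟩ := exists_minimal_l1 (bowtieLattice a) x
  suffices h : ∃ l' ∈ bowtieLattice a, 2 * (l1 (x - l - l') : ℤ) ≤ 5 * a by
    obtain ⟨l', hl', h⟩ := h
    exact ⟨l + l', add_mem hl hl', by rwa [← sub_sub]⟩
  generalize x - l = y at hmin
  have hmin' : ∀ c₀ c₁ c₂ c₃ c₄ : ℤ, |y 0| + |y 1| + |y 2| + |y 3| + |y 4| ≤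
      |y 0 - (2 * a * c₀ - c₂ + c₃)| + |y 1 - (2 * a * c₁ + c₃ - c₄)| +
      |y 2 - (2 * a * c₂ + c₀ - c₃)| + |y 3 - (2 * a * c₃ - c₀ - c₁ + c₂ + c₄)| +
      |y 4 - (2 * a * c₄ + c₁ - c₃)| := by
    intro c₀ c₁ c₂ c₃ c₄
    have h := Int.ofNat_le.2 (hmin _ (bowtieVec_mem a c₀ c₁ c₂ c₃ c₄ 0))
    rw [l1_sub_bowtieVec, coe_l1] at h
    simpa using h
  clear hmin
  -- Minimality is tested against each column and its negative: two off-diagonal entries give the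
  -- bound a + 1, four give a + 2.
  have add1 : ∀ t : ℤ, |t + 1| ≤ |t| + 1 := fun t => abs_add_le t 1
  have sub1 : ∀ t : ℤ, |t - 1| ≤ |t| + 1 := fun t => abs_sub t 1
  have b0 : 2 * |y 0| ≤ 2 * a + 2 := by
    have h := hmin' 1 0 0 0 0
    have h' := hmin' (-1) 0 0 0 0
    simp at h h'
    refine abs_le_of_minimal ha (by norm_num) ?_ ?_ <;>
      linarith [add1 (y 2), sub1 (y 2), add1 (y 3), sub1 (y 3)]
  have b1 : 2 * |y 1| ≤ 2 * a + 2 := by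
    have h := hmin' 0 1 0 0 0
    have h' := hmin' 0 (-1) 0 0 0
    simp at h h'
    refine abs_le_of_minimal ha (by norm_num) ?_ ?_ <;>
      linarith [add1 (y 4), sub1 (y 4), add1 (y 3), sub1 (y 3)]
  have b2 : 2 * |y 2| ≤ 2 * a + 2 := by
    have h := hmin' 0 0 1 0 0
    have h' := hmin' 0 0 (-1) 0 0
    simp at h h'
    refine abs_le_of_minimal ha (by norm_num) ?_ ?_ <;>
      linarith [add1 (y 0), sub1 (y 0), add1 (y 3), sub1 (y 3)]
  have b4 : 2 * |y 4| ≤ 2 * a + 2 := by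
    have h := hmin' 0 0 0 0 1
    have h' := hmin' 0 0 0 0 (-1)
    simp at h h'
    refine abs_le_of_minimal ha (by norm_num) ?_ ?_ <;>
      linarith [add1 (y 1), sub1 (y 1), add1 (y 3), sub1 (y 3)]
  have h3 := hmin' 0 0 0 1 0
  have h3' := hmin' 0 0 0 (-1) 0
  simp at h3 h3'
  have b3 : 2 * |y 3| ≤ 2 * a + 4 := by
    refine abs_le_of_minimal ha (by norm_num) ?_ ?_ <;>
      linarith [add1 (y 0), sub1 (y 0), add1 (y 1), sub1 (y 1), add1 (y 2), sub1 (y 2),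
        add1 (y 4), sub1 (y 4)]
  have add_neg : ∀ t : ℤ, t < 0 → |t + 1| ≤ |t| - 1 := fun t ht => by
    rw [abs_of_neg ht, abs_of_nonpos (by omega)]; omega
  have sub_pos : ∀ t : ℤ, 0 < t → |t - 1| ≤ |t| - 1 := fun t ht => by
    rw [abs_of_pos ht, abs_of_nonneg (by omega)]
  have b3' := abs_le.1 (show |y 3| ≤ a + 2 by omega)
  by_cases hs : |y 3| ≤ a - 2
  · exact exists_close_of_reduced ha (by omega) (by omega) (by omega) (by omega) hs
  rw [abs_le] at hs
  rcases le_or_gt 0 (y 3) with hy | hy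
  · obtain ⟨l', hl', k0, k1, k2, k4, k3⟩ := exists_reduced_of_large ha (x := y) (by omega) (by omega)
      (by omega) (by omega) (by omega) (by omega) (fun e => by
        -- Subtracting the column saves 4 in this coordinate, so by minimality each of the four
        -- neighbours must grow by 1, which fixes its sign.
        rw [e, abs_of_neg (by omega : a + 2 - 2 * a < 0), abs_of_pos (by omega : 0 < a + 2)] at h3
        refine ⟨?_, ?_, ?_, ?_⟩ <;> by_contra! hc
        · linarith [sub_pos _ hc, sub1 (y 1), add1 (y 2), add1 (y 4)]
        · linarith [sub_pos _ hc, sub1 (y 0), add1 (y 2), add1 (y 4)]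
        · linarith [add_neg _ hc, sub1 (y 0), sub1 (y 1), add1 (y 4)]
        · linarith [add_neg _ hc, sub1 (y 0), sub1 (y 1), add1 (y 2)])
    obtain ⟨l'', hl'', h⟩ := exists_close_of_reduced ha k0 k1 k2 k4 k3
    exact ⟨l' + l'', add_mem hl' hl'', by rwa [← sub_sub]⟩
  · obtain ⟨l', hl', k0, k1, k2, k4, k3⟩ := exists_reduced_of_large ha (x := -y)
      (by simp only [Pi.neg_apply, abs_neg]; omega) (by simp only [Pi.neg_apply, abs_neg]; omega)
      (by simp only [Pi.neg_apply, abs_neg]; omega) (by simp only [Pi.neg_apply, abs_neg]; omega)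
      (by simp only [Pi.neg_apply]; omega) (by simp only [Pi.neg_apply]; omega) (fun e => by
        simp only [Pi.neg_apply] at e ⊢
        rw [abs_of_neg hy, abs_of_pos (by omega : 0 < y 3 + 2 * a)] at h3'
        refine ⟨?_, ?_, ?_, ?_⟩ <;> by_contra! hc
        · linarith [add_neg (y 0) (by omega), add1 (y 1), sub1 (y 2), sub1 (y 4)]
        · linarith [add_neg (y 1) (by omega), add1 (y 0), sub1 (y 2), sub1 (y 4)]
        · linarith [sub_pos (y 2) (by omega), add1 (y 0), add1 (y 1), sub1 (y 4)]
        · linarith [sub_pos (y 4) (by omega), add1 (y 0), add1 (y 1), sub1 (y 2)])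
    obtain ⟨l'', hl'', h⟩ := exists_close_of_reduced ha k0 k1 k2 k4 k3
    refine ⟨-(l' + l''), neg_mem (add_mem hl' hl''), ?_⟩
    have e : y - -(l' + l'') = -(-y - l' - l'') := by abel
    have e' : l1 (-(-y - l' - l'')) = l1 (-y - l' - l'') := by
      simp only [l1, Pi.neg_apply (-y - l' - l''), Int.natAbs_neg]
    rwa [e, e']

/-! ### The lattice as the kernel of the generators -/

/-- The order of the circulant graph of diameter `15 m + 12`. -/
def circOrder (m : ℕ) : ℕ :=
  124416 * m ^ 5 + 518400 * m ^ 4 + 869184 * m ^ 3 + 732960 * m ^ 2 + 310830 * m + 53025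

/-- The generators of the circulant graph of diameter `15 m + 12`. -/
def circGen (m : ℕ) : Fin 5 → ℕ :=
  ![1, 10368 * m ^ 4 + 34560 * m ^ 3 + 43560 * m ^ 2 + 24600 * m + 5251,
    41472 * m ^ 5 + 176256 * m ^ 4 + 300960 * m ^ 3 + 258168 * m ^ 2 + 111276 * m + 19281,
    41472 * m ^ 5 + 176256 * m ^ 4 + 300960 * m ^ 3 + 258168 * m ^ 2 + 111288 * m + 19291,
    41472 * m ^ 5 + 176256 * m ^ 4 + 301824 * m ^ 3 + 260328 * m ^ 2 + 113106 * m + 19806]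

lemma circOrder_dvd_iff (m : ℕ) (x : Fin 5 → ℤ) :
    (circOrder m : ℤ) ∣ ∑ i, x i * circGen m i ↔ x ∈ bowtieLattice (6 * m + 5) := by
  rw [mem_bowtieLattice_iff]
  simp only [Fin.sum_univ_five, circGen, circOrder, Matrix.cons_val]
  push_cast
  generalize (m : ℤ) = m
  constructor
  · rintro ⟨t, ht⟩
    -- The lattice coordinates of x, with `x 0` eliminated through `ht`.
    refine ⟨(10368 * m ^ 4 + 34560 * m ^ 3 + 43488 * m ^ 2 + 24480 * m + 5200) * t +
        (-864 * m ^ 3 - 2160 * m ^ 2 - 1818 * m - 515) * x 1 +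
        (-3456 * m ^ 4 - 11808 * m ^ 3 - 15192 * m ^ 2 - 8730 * m - 1891) * x 2 +
        (-3456 * m ^ 4 - 11808 * m ^ 3 - 15192 * m ^ 2 - 8730 * m - 1892) * x 3 +
        (-3456 * m ^ 4 - 11808 * m ^ 3 - 15264 * m ^ 2 - 8850 * m - 1943) * x 4,
      (-72 * m ^ 2 - 120 * m - 50) * t + (6 * m + 5) * x 1 + (24 * m ^ 2 + 42 * m + 18) * x 2 +
        (24 * m ^ 2 + 42 * m + 18) * x 3 + (24 * m ^ 2 + 42 * m + 18) * x 4,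
      (-864 * m ^ 3 - 2088 * m ^ 2 - 1698 * m - 465) * t + (72 * m ^ 2 + 114 * m + 46) * x 1 +
        (288 * m ^ 3 + 720 * m ^ 2 + 602 * m + 169) * x 2 +
        (288 * m ^ 3 + 720 * m ^ 2 + 602 * m + 169) * x 3 +
        (288 * m ^ 3 + 720 * m ^ 2 + 608 * m + 173) * x 4,
      (864 * m ^ 3 + 2232 * m ^ 2 + 1926 * m + 555) * t + (-72 * m ^ 2 - 126 * m - 55) * x 1 +
        (-288 * m ^ 3 - 768 * m ^ 2 - 682 * m - 202) * x 2 +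
        (-288 * m ^ 3 - 768 * m ^ 2 - 682 * m - 202) * x 3 +
        (-288 * m ^ 3 - 768 * m ^ 2 - 688 * m - 208) * x 4,
      (72 * m ^ 2 + 132 * m + 60) * t + (-6 * m - 6) * x 1 + (-24 * m ^ 2 - 46 * m - 22) * x 2 +
        (-24 * m ^ 2 - 46 * m - 22) * x 3 + (-24 * m ^ 2 - 46 * m - 23) * x 4,
      t + x 4, ?_, ?_, ?_, ?_, ?_⟩
    · linear_combination ht
    all_goals ring
  · rintro ⟨c₀, c₁, c₂, c₃, c₄, e, h0, h1, h2, h3, h4⟩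
    -- The coefficients are the multiples of n to which the basis columns map; that of e is half the
    -- sum of the others.
    refine ⟨c₁ + (4 * m + 4) * c₂ + (4 * m + 3) * c₃ + (4 * m + 4) * c₄ + (6 * m + 6) * e, ?_⟩
    rw [h0, h1, h2, h3, h4]
    ring

lemma sum_zsmul_eq_zero_iff (m : ℕ) (x : Fin 5 → ℤ) :
    ∑ i, x i • (circGen m i : ZMod (circOrder m)) = 0 ↔ x ∈ bowtieLattice (6 * m + 5) := by
  rw [← circOrder_dvd_iff, ← ZMod.intCast_zmod_eq_zero_iff_dvd]
  simp

/-! ### Diameter, distinct generators and degree -/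

/-- The circulant graph of diameter `15 m + 12`. -/
abbrev circGraph (m : ℕ) : SimpleGraph (ZMod (circOrder m)) :=
  SimpleGraph.circulantGraph (Set.range fun i => (circGen m i : ZMod (circOrder m)))

lemma sum_sub_zsmul {G : Type*} [AddCommGroup G] (g : Fin 5 → G) (x y : Fin 5 → ℤ) :
    ∑ i, (x - y) i • g i = ∑ i, x i • g i - ∑ i, y i • g i := by
  simp [sub_smul]

lemma circGraph_edist_le (m : ℕ) (u v : ZMod (circOrder m)) :
    (circGraph m).edist u v ≤ ((15 * m + 12 : ℕ) : ℕ∞) := by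
  obtain ⟨r, hr⟩ := ZMod.intCast_surjective (v - u)
  obtain ⟨l, hl, h⟩ := exists_close (a := 6 * m + 5) (by omega) (Pi.single 0 r)
  have hv : v = u + ∑ i, (Pi.single 0 r - l : Fin 5 → ℤ) i •
      (circGen m i : ZMod (circOrder m)) := by
    rw [sum_sub_zsmul, (sum_zsmul_eq_zero_iff m l).2 hl, Finset.sum_eq_single 0]
    · simp [circGen, hr]
    · intro i _ hi
      simp [hi]
    · simp
  rw [hv]
  refine (edist_add_sum_zsmul_le _ _ _ _).trans (Nat.cast_le.2 ?_)
  unfold l1 at h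
  omega

lemma exists_le_circGraph_edist (m : ℕ) :
    ∃ v, ((15 * m + 12 : ℕ) : ℕ∞) ≤ (circGraph m).edist 0 v := by
  set z : Fin 5 → ℤ := ![3 * m + 2, 3 * m + 2, 3 * m + 2, 3 * m + 2 + 1, 3 * m + 2 + 1] with hz
  refine ⟨∑ i, z i • (circGen m i : ZMod (circOrder m)), ?_⟩
  by_contra! hlt
  obtain ⟨p, hp⟩ := SimpleGraph.exists_walk_of_edist_ne_top hlt.ne_top
  rw [← hp, Nat.cast_lt] at hlt
  obtain ⟨x, hx, e⟩ := exists_coeff_of_walk _ p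
  have hl : z - x ∈ bowtieLattice (2 * (3 * m + 2) + 1) := by
    have : z - x ∈ bowtieLattice (6 * m + 5) := by
      rw [← sum_zsmul_eq_zero_iff, sum_sub_zsmul, ← e]
      simp
    convert this using 1
    ring_nf
  have := le_l1_deepHole_sub (by omega) hl
  rw [← hz, sub_sub_cancel] at this
  omega

lemma circGraph_ediam (m : ℕ) : (circGraph m).ediam = ((15 * m + 12 : ℕ) : ℕ∞) := by
  refine le_antisymm (SimpleGraph.ediam_le_of_edist_le (circGraph_edist_le m)) ?_
  obtain ⟨v, hv⟩ := exists_le_circGraph_edist m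
  exact hv.trans SimpleGraph.edist_le_ediam

lemma circGen_strictMono (m : ℕ) : StrictMono (circGen m) := by
  have h : circGen m 0 < circGen m 1 ∧ circGen m 1 < circGen m 2 ∧
      circGen m 2 < circGen m 3 ∧ circGen m 3 < circGen m 4 := by
    simp only [circGen, Matrix.cons_val]
    omega
  rw [Fin.strictMono_iff_lt_succ]
  intro i
  fin_cases i
  exacts [h.1, h.2.1, h.2.2.1, h.2.2.2]

lemma circGen_pos (m : ℕ) (i : Fin 5) : 0 < circGen m i :=
  Nat.lt_of_lt_of_le Nat.one_pos ((circGen_strictMono m).monotone (Fin.zero_le i))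

lemma two_mul_circGen_lt (m : ℕ) (i : Fin 5) : 2 * circGen m i < circOrder m := by
  have h : circGen m i ≤ circGen m 4 := (circGen_strictMono m).monotone (Fin.le_last i)
  have h' : 2 * circGen m 4 < circOrder m := by
    simp only [circGen, circOrder, Matrix.cons_val]
    omega
  omega

/-- Applied to ±gᵢ, all of size below n/2, this makes the ten neighbours distinct. -/
lemma intCast_injOn {n : ℕ} : Set.InjOn ((↑) : ℤ → ZMod n) {z | 2 * |z| < n} := by
  intro x hx y hy h
  rw [ZMod.intCast_eq_intCast_iff_dvd_sub] at h
  have : |y - x| < n := by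
    have := abs_sub y x
    simp only [Set.mem_ofPred_eq] at hx hy
    omega
  linarith [Int.eq_zero_of_abs_lt_dvd h this]

lemma circGen_cast_injective (m : ℕ) :
    Function.Injective fun i => (circGen m i : ZMod (circOrder m)) := by
  intro i j h
  have h' : ((circGen m i : ℤ) : ZMod (circOrder m)) = (circGen m j : ℤ) := by simpa using h
  have hi := two_mul_circGen_lt m i
  have hj := two_mul_circGen_lt m j
  have := intCast_injOn (by simp only [Set.mem_ofPred_eq, Nat.abs_cast]; omega)
    (by simp only [Set.mem_ofPred_eq, Nat.abs_cast]; omega) h'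
  exact (circGen_strictMono m).injective (by omega)

lemma circGraph_neighborSet_ncard (m : ℕ) (v : ZMod (circOrder m)) :
    ((circGraph m).neighborSet v).ncard = 10 := by
  have inj : Function.Injective fun p : Fin 5 × Bool =>
      v + (((if p.2 then 1 else -1) * circGen m p.1 : ℤ) : ZMod (circOrder m)) := by
    rintro ⟨i, b⟩ ⟨j, b'⟩ h
    have bd : ∀ (i : Fin 5) (b : Bool),
        2 * |(if b then 1 else -1) * (circGen m i : ℤ)| < circOrder m := by
      intro i b
      have := two_mul_circGen_lt m i
      cases b <;> simp <;> omega
    have h' := intCast_injOn (bd i b) (bd j b') (add_left_cancel h)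
    have hi := circGen_pos m i
    have hj := circGen_pos m j
    have hb : b = b' := by
      cases b <;> cases b' <;> simp at h' ⊢ <;> omega
    have hij : circGen m i = circGen m j := by
      subst hb
      cases b <;> simp at h' <;> omega
    exact Prod.ext ((circGen_strictMono m).injective hij) hb
  have hset : (circGraph m).neighborSet v = Set.range fun p : Fin 5 × Bool =>
      v + (((if p.2 then 1 else -1) * circGen m p.1 : ℤ) : ZMod (circOrder m)) := by
    ext w
    rw [SimpleGraph.mem_neighborSet, circGraph, SimpleGraph.circulantGraph, SimpleGraph.fromRel_adj]
    constructor
    · rintro ⟨-, ⟨i, hi⟩ | ⟨i, hi⟩⟩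
      · exact ⟨(i, false), by simp at hi ⊢; rw [hi]; ring⟩
      · exact ⟨(i, true), by simp at hi ⊢; rw [hi]; ring⟩
    · rintro ⟨⟨i, b⟩, rfl⟩
      refine ⟨fun h => ?_, ?_⟩
      · have hz : ((0 : ℤ) : ZMod (circOrder m)) =
            (((if b then 1 else -1) * circGen m i : ℤ) : ZMod (circOrder m)) := by
          rw [Int.cast_zero]
          exact (left_eq_add.1 h).symm
        have hp := circGen_pos m i
        have hl := two_mul_circGen_lt m i
        have := intCast_injOn (by simp; omega)
          (by cases b <;> simp <;> omega) hz
        cases b <;> simp at this <;> omega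
      · cases b
        · exact Or.inl ⟨i, by simp⟩
        · exact Or.inr ⟨i, by simp⟩
  rw [hset, ← Set.image_univ, Set.ncard_image_of_injective _ inj, Set.ncard_univ]
  simp

theorem theorem7 (k : ℕ) (hk : k ≡ 12 [MOD 15]) :
    ∃ n g₂ g₃ g₄ g₅ : ℕ,
      -- the order and the generators are integers, given by polynomials in `k`
      (n : ℚ) = (512 * (k : ℚ) ^ 5 + 1280 * (k : ℚ) ^ 4 + 6080 * (k : ℚ) ^ 3
        + 7840 * (k : ℚ) ^ 2 + 10010 * (k : ℚ) + 3741) / 3125 ∧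
      (g₂ : ℚ) = (128 * (k : ℚ) ^ 4 + 256 * (k : ℚ) ^ 3 + 1192 * (k : ℚ) ^ 2
        + 1064 * (k : ℚ) + 883) / 625 ∧
      (g₃ : ℚ) = (512 * (k : ℚ) ^ 5 + 1920 * (k : ℚ) ^ 4 + 6560 * (k : ℚ) ^ 3
        + 14600 * (k : ℚ) ^ 2 + 7980 * (k : ℚ) + 10431) / 9375 ∧
      (g₄ : ℚ) = (512 * (k : ℚ) ^ 5 + 1920 * (k : ℚ) ^ 4 + 6560 * (k : ℚ) ^ 3
        + 14600 * (k : ℚ) ^ 2 + 15480 * (k : ℚ) + 14181) / 9375 ∧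
      (g₅ : ℚ) = (512 * (k : ℚ) ^ 5 + 1920 * (k : ℚ) ^ 4 + 8960 * (k : ℚ) ^ 3
        + 18200 * (k : ℚ) ^ 2 + 28530 * (k : ℚ) + 20106) / 9375 ∧
      Nat.card (ZMod n) = n ∧
      -- the generating set consists of five elements of the cyclic group `ZMod n`
      ({1, (g₂ : ZMod n), (g₃ : ZMod n), (g₄ : ZMod n), (g₅ : ZMod n)} :
        Set (ZMod n)).ncard = 5 ∧
      -- the graph is regular of degree 10
      (∀ v : ZMod n, ((SimpleGraph.circulantGraph
        ({1, (g₂ : ZMod n), (g₃ : ZMod n), (g₄ : ZMod n), (g₅ : ZMod n)} :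
          Set (ZMod n))).neighborSet v).ncard = 10) ∧
      -- the graph is connected and its diameter is exactly `k`
      (SimpleGraph.circulantGraph
        ({1, (g₂ : ZMod n), (g₃ : ZMod n), (g₄ : ZMod n), (g₅ : ZMod n)} :
          Set (ZMod n))).Connected ∧
      (SimpleGraph.circulantGraph
        ({1, (g₂ : ZMod n), (g₃ : ZMod n), (g₄ : ZMod n), (g₅ : ZMod n)} :
          Set (ZMod n))).ediam = (k : ℕ∞) := by
  obtain ⟨m, rfl⟩ : ∃ m, k = 15 * m + 12 := ⟨k / 15, by unfold Nat.ModEq at hk; omega⟩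
  have hset : ({1, (circGen m 1 : ZMod (circOrder m)), (circGen m 2 : ZMod (circOrder m)),
      (circGen m 3 : ZMod (circOrder m)), (circGen m 4 : ZMod (circOrder m))} :
      Set (ZMod (circOrder m))) = Set.range fun i => (circGen m i : ZMod (circOrder m)) := by
    have h1 : (1 : ZMod (circOrder m)) = (circGen m 0 : ZMod (circOrder m)) := by simp [circGen]
    ext y
    rw [h1]
    simp only [Set.mem_insert_iff, Set.mem_singleton_iff, Set.mem_range, Fin.exists_fin_succ]
    simp [eq_comm]
  refine ⟨circOrder m, circGen m 1, circGen m 2, circGen m 3, circGen m 4, ?_, ?_, ?_, ?_, ?_,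
    Nat.card_zmod _, ?_, ?_, ?_, ?_⟩
  · simp only [circOrder]; push_cast; ring
  · simp only [circGen, Matrix.cons_val]; push_cast; ring
  · simp only [circGen, Matrix.cons_val]; push_cast; ring
  · simp only [circGen, Matrix.cons_val]; push_cast; ring
  · simp only [circGen, Matrix.cons_val]; push_cast; ring
  · rw [hset, ← Set.image_univ, Set.ncard_image_of_injective _ (circGen_cast_injective m),
      Set.ncard_univ]
    simp
  · rw [hset]
    exact circGraph_neighborSet_ncard m
  · rw [hset]
    refine SimpleGraph.connected_of_ediam_ne_top ?_
    rw [circGraph_ediam]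
    exact ENat.natCast_ne_top _
  · rw [hset]
    exact circGraph_ediam m
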